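/- \textbf{Theorem.} Let $(\mathcal S,\mathcal A,P,r,\gamma)$ be a Markov decision process with finite state space $\mathcal S$, finite action space $\mathcal A$, transition probabilities $P(s'|s,a)$, reward $r(s,a,s')\in\mathbb R$ and discount factor $\gamma\in(0,1)$. Let $\pi$ (target) and $\beta$ (behavior) be stochastic policies with $\pi(a|s)=0$ whenever $\beta(a|s)=0$, and let $d^\beta$ be a stationary distribution of the state under $\beta$ with $d^\beta(s)>0$ for all $s$; put $D=\operatorname{diag}(d^\beta)$. Let $\Phi\in\mathbb R^{|\mathcal S|\times q}$ have full column rank, with rows $\phi(s)^T$. Let $P^\pi(s'|s)=\sum_a P(s'|s,a)\pi(a|s)$, $R^\pi(s)=\sum_{a,s'}\pi(a|s)P(s'|s,a)r(s,a,s')$, and $$B=\Phi^TD\Phi,\qquad A=\Phi^TD(\gamma P^\pi-I)\Phi,\qquad b=\Phi^TDR^\pi .$$ Let $\sigma\ge 0$; if $\sigma=0$, assume moreover that either $\pi=\beta$ or $A$ is nonsingular. Consider $$L(\theta,\lambda)=\tfrac{\sigma}{2}\theta^TB\theta+\lambda^T\Phi^TD(R^\pi+\gamma P^\pi\Phi\theta-\Phi\theta)-\tfrac12\lambda^TB\lambda,\qquad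 \theta,\lambda\in\mathbb R^q .$$ Let $(s_k,a_k,s_k')_{k\ge0}$ be i.i.d. with $s_k\sim d^\beta$, $a_k\sim\beta(\cdot|s_k)$, $s_k'\sim P(\cdot|s_k,a_k)$. Let the (deterministic) step sizes satisfy $\alpha_k>0$, $\sum_k\alpha_k=\infty$, $\sum_k\alpha_k^2<\infty$. For arbitrary $\theta_0,\lambda_0\in\mathbb R^q$ let $(\theta_k,\lambda_k)$ be the iterates of GTD4, \begin{align*} \theta_{k+1}&=\theta_k+\alpha_k\big[(\phi_k-\gamma\rho_k\phi_k')(\phi_k^T\lambda_k)-\phi_k(\phi_k^T\theta_k)\big],\\ \lambda_{k+1}&=\lambda_k+\alpha_k(\delta_k-\sigma\phi_k^T\lambda_k)\phi_k, \end{align*} where $\phi_k=\phi(s_k)$, $\phi_k'=\phi(s_k')$, $\rho_k=\pi(a_k|s_k)/\beta(a_k|s_k)$, $r_k=r(s_k,a_k,s_k')$ and $\delta_k=\rho_kr_k+\gamma\rho_k\phi_k'^T\theta_k-\phi_k^T\theta_k$. Then $L$ has a unique saddle point $(\hat\theta_\sigma,\hat\lambda_\sigma)$, that is, a unique pair with $L(\hat\theta_\sigma,\lambda)\le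 L(\hat\theta_\sigma,\hat\lambda_\sigma)\le L(\theta,\hat\lambda_\sigma)$ for all $\theta,\lambda\in\mathbb R^q$, and $$\theta_k\to\hat\theta_\sigma\quad\text{as } k\to\infty,\ \text{with probability one.}$$ Moreover, $A$ is nonsingular if $\pi=\beta$; and whenever $A$ is nonsingular, $A+\sigma E$ is nonsingular and $$\hat\theta_\sigma=-(A+\sigma E)^{-1}b,\qquad E=B\,(A^T)^{-1}B .$$ -/

import Mathlib

open Matrix MeasureTheory ProbabilityTheory Filter Topology

namespace GTD

/-- A Markov decision process with finite state space `S`, finite action space `A`, transition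
probabilities `P s a s'` (from `s` to `s'` under action `a`), reward `r s a s'` and discount factor
`γ` in the open unit interval. -/
structure MDP (S A : Type*) [Fintype S] where
  P : S → A → S → ℝ
  P_nonneg : ∀ s a s', 0 ≤ P s a s'
  P_sum : ∀ s a, ∑ s', P s a s' = 1
  r : S → A → S → ℝ
  γ : ℝ
  γ_pos : 0 < γ
  γ_lt_one : γ < 1

/-- A stochastic policy; `prob s a` is the probability of the action `a` in the state `s`. -/
structure Policy (S A : Type*) [Fintype A] where
  prob : S → A → ℝ
  nonneg : ∀ s a, 0 ≤ prob s a
  sum_eq_one : ∀ s, ∑ a, prob s a = 1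

section Model

variable {S A : Type*} [Fintype S] [DecidableEq S] [Fintype A]

/-- The state transition matrix under a policy. -/
def MDP.transMatrix (M : MDP S A) (π : Policy S A) : Matrix S S ℝ :=
  Matrix.of fun s s' => ∑ a, M.P s a s' * π.prob s a

/-- The expected one-step reward under a policy. -/
def MDP.expReward (M : MDP S A) (π : Policy S A) : S → ℝ :=
  fun s => ∑ a, ∑ s', π.prob s a * M.P s a s' * M.r s a s'

/-- `d` is a stationary distribution of the state under the policy `β`, all of whose entries are
positive. -/
structure IsPosStationary (M : MDP S A) (β : Policy S A) (d : S → ℝ) : Prop where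
  pos : ∀ s, 0 < d s
  sum_eq_one : ∑ s, d s = 1
  stationary : ∀ s', ∑ s, d s * M.transMatrix β s s' = d s'

variable {q : ℕ}

/-- The matrix `Φᵀ D Φ`, where `D = diag d`. -/
def gram (Φ : Matrix S (Fin q) ℝ) (d : S → ℝ) : Matrix (Fin q) (Fin q) ℝ :=
  Φᵀ * Matrix.diagonal d * Φ

/-- The matrix `Φᵀ D (γ P^π - I) Φ`. -/
noncomputable def tdMatrix (M : MDP S A) (π : Policy S A) (Φ : Matrix S (Fin q) ℝ) (d : S → ℝ) :
    Matrix (Fin q) (Fin q) ℝ :=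
  Φᵀ * Matrix.diagonal d * (M.γ • M.transMatrix π - 1) * Φ

/-- The bias matrix `E = Φᵀ D Φ (Φᵀ (γ P^π - I)ᵀ D Φ)⁻¹ Φᵀ D Φ`. -/
noncomputable def biasMatrix (M : MDP S A) (π : Policy S A) (Φ : Matrix S (Fin q) ℝ) (d : S → ℝ) :
    Matrix (Fin q) (Fin q) ℝ :=
  gram Φ d * (Φᵀ * (M.γ • M.transMatrix π - 1)ᵀ * Matrix.diagonal d * Φ)⁻¹ * gram Φ d

/-- The vector `-(Φᵀ D (γ P^π - I) Φ + σ E)⁻¹ Φᵀ D R^π`. -/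
noncomputable def thetaHat (M : MDP S A) (π : Policy S A) (Φ : Matrix S (Fin q) ℝ) (d : S → ℝ)
    (σ : ℝ) : Fin q → ℝ :=
  -((tdMatrix M π Φ d + σ • biasMatrix M π Φ d)⁻¹ *ᵥ
    (Φᵀ *ᵥ (Matrix.diagonal d *ᵥ M.expReward π)))

/-- The function
`L(θ, w) = (σ/2) θᵀ Φᵀ D Φ θ + wᵀ Φᵀ D (R^π + γ P^π Φ θ - Φ θ) - (1/2) wᵀ Φᵀ D Φ w`. -/
noncomputable def lagrangian (M : MDP S A) (π : Policy S A) (Φ : Matrix S (Fin q) ℝ) (d : S → ℝ)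
    (σ : ℝ) (θ w : Fin q → ℝ) : ℝ :=
  σ / 2 * (θ ⬝ᵥ (gram Φ d *ᵥ θ))
    + w ⬝ᵥ (Φᵀ *ᵥ (Matrix.diagonal d *ᵥ
        (M.expReward π + M.γ • (M.transMatrix π *ᵥ (Φ *ᵥ θ)) - Φ *ᵥ θ)))
    - 1 / 2 * (w ⬝ᵥ (gram Φ d *ᵥ w))

/-- `p = (θ*, w*)` is a saddle point of `L` (minimal in the first, maximal in the second
argument). -/
def IsSaddlePoint {n : ℕ} (L : (Fin n → ℝ) → (Fin n → ℝ) → ℝ)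
    (p : (Fin n → ℝ) × (Fin n → ℝ)) : Prop :=
  ∀ θ w : Fin n → ℝ, L p.1 w ≤ L p.1 p.2 ∧ L p.1 p.2 ≤ L θ p.2

/-- The importance sampling ratio. -/
noncomputable def impRatio (π β : Policy S A) (s : S) (a : A) : ℝ :=
  π.prob s a / β.prob s a

/-- The temporal difference error `ρ r + γ ρ φ(s')ᵀ θ - φ(s)ᵀ θ` of the observed transition
`x = (s, a, s')`. -/
noncomputable def tdError (M : MDP S A) (π β : Policy S A) (Φ : Matrix S (Fin q) ℝ)
    (x : S × A × S) (θ : Fin q → ℝ) : ℝ :=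
  impRatio π β x.1 x.2.1 * M.r x.1 x.2.1 x.2.2
    + M.γ * impRatio π β x.1 x.2.1 * (Φ x.2.2 ⬝ᵥ θ) - Φ x.1 ⬝ᵥ θ

/-- The iterates `(θ_k, λ_k)` of GTD4 with step sizes `α` and initial pair `z₀`, along the sequence
`x` of observed transitions `x k = (s_k, a_k, s_k')`. -/
noncomputable def gtd4 (M : MDP S A) (π β : Policy S A) (Φ : Matrix S (Fin q) ℝ) (σ : ℝ)
    (α : ℕ → ℝ) (z₀ : (Fin q → ℝ) × (Fin q → ℝ)) (x : ℕ → S × A × S) :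
    ℕ → (Fin q → ℝ) × (Fin q → ℝ)
  | 0 => z₀
  | k + 1 =>
    let θ := (gtd4 M π β Φ σ α z₀ x k).1
    let w := (gtd4 M π β Φ σ α z₀ x k).2
    let φ := Φ (x k).1
    let φ' := Φ (x k).2.2
    let ρ := impRatio π β (x k).1 (x k).2.1
    (θ + α k • ((φ ⬝ᵥ w) • (φ - (M.γ * ρ) • φ') - (φ ⬝ᵥ θ) • φ),
      w + α k • ((tdError M π β Φ (x k) θ - σ * (φ ⬝ᵥ w)) • φ))

/-- The observed transitions `(s_k, a_k, s_k')` are independent and identically distributed, with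
`s_k ∼ d`, `a_k ∼ β(· | s_k)` and `s_k' ∼ P(· | s_k, a_k)`. -/
structure IsSampling {Ω : Type*} [MeasurableSpace Ω] [MeasurableSpace S] [MeasurableSpace A]
    (M : MDP S A) (β : Policy S A) (d : S → ℝ) (μ : Measure Ω) (X : ℕ → Ω → S × A × S) : Prop where
  measurable : ∀ k, Measurable (X k)
  indep : iIndepFun X μ
  law : ∀ k s a s', μ {ω | X k ω = (s, a, s')} = ENNReal.ofReal (d s * β.prob s a * M.P s a s')

end Model

end GTD

/-! Averaging one GTD4 step over a transition gives the affine mean field `(θ, w) ↦ (-Aᵀ w - B θ, A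
θ - σ B w + b)`, because the importance ratio turns `β`-averages into `π`-averages. Its zero `(θ,
w)` satisfies `B θ = -Aᵀ w` and `A θ + b = σ B w`, so `(θ, σ w)` solves the critical point equations
of the convex-concave function `L`, which characterise its saddle points (`isSaddlePoint_iff`). Thus
`θ_k` converges to the saddle component, while the second iterate tends to `w`, which is multiplied
by `σ` to obtain the multiplier.

Convergence rests on an inner product `Q` for which the linear mean field is strictly dissipative
(`exists_lyapunovForm`). For `σ > 0` the Euclidean one serves. For `σ = 0` it yields only `-θᵀ B θ`,
blind to `w`; a small cross term between `θ` and `Aᵀ w` supplies the missing decay when `A` is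
nonsingular. Dissipativity also makes the linear mean field injective, hence bijective, so the
equilibrium exists.

For the error `e` from equilibrium, `V = Q(e, e)` then has conditional mean at most `(1 + K α_k²) V
- c α_k V + K α_k²` after one step, and a Robbins-Siegmund argument forces `V → 0` almost surely
(`ae_tendsto_of_linear_recursion`). On-policy, `A` is negative definite because `P^β` does not
expand the `d`-weighted norm. -/

namespace GTD

/-! ### Almost sure convergence of stochastic recursions with negative mean drift -/

section StochasticApproximation

/-- A nonnegative supermartingale converges almost surely. -/
theorem ae_exists_tendsto_of_supermartingale_nonneg {Ω : Type*} [mΩ : MeasurableSpace Ω]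
    {μ : Measure Ω} [IsFiniteMeasure μ] {ℱ : Filtration ℕ mΩ} {f : ℕ → Ω → ℝ}
    (hf : Supermartingale f ℱ μ) (h0 : ∀ k ω, 0 ≤ f k ω) :
    ∀ᵐ ω ∂μ, ∃ l, Tendsto (fun k => f k ω) atTop (𝓝 l) := by
  -- For nonnegative `f` the L¹ norm is the mean, which does not increase; so `-f` is an L¹-bounded
  -- submartingale.
  have hbdd : ∀ n, eLpNorm ((-f) n) 1 μ ≤ ((∫ ω, f 0 ω ∂μ).toNNReal : ENNReal) := by
    intro n
    have hle : ∫ ω, f n ω ∂μ ≤ ∫ ω, f 0 ω ∂μ := by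
      simpa using hf.setIntegral_le (Nat.zero_le n) MeasurableSet.univ
    rw [Pi.neg_apply, eLpNorm_neg, eLpNorm_one_eq_lintegral_enorm,
      ← ofReal_integral_norm_eq_lintegral_enorm (hf.integrable n)]
    have : ∀ ω, ‖f n ω‖ = f n ω := fun ω => Real.norm_of_nonneg (h0 n ω)
    simp only [this]
    exact ENNReal.ofReal_le_ofReal hle
  filter_upwards [hf.neg.exists_ae_tendsto_of_bdd hbdd] with ω ⟨l, hl⟩
  exact ⟨-l, by simpa using hl.neg⟩

/-- A convergent nonnegative sequence whose weighted sums stay bounded although the sum of the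
weights diverges tends to zero. -/
theorem tendsto_zero_of_weighted_sum_le {α u : ℕ → ℝ} {l C : ℝ} (hα : ∀ k, 0 ≤ α k)
    (hαsum : Tendsto (fun n => ∑ k ∈ Finset.range n, α k) atTop atTop)
    (hu : ∀ k, 0 ≤ u k) (hl : Tendsto u atTop (𝓝 l))
    (hC : ∀ n, ∑ k ∈ Finset.range n, α k * u k ≤ C) : Tendsto u atTop (𝓝 0) := by
  have hl0 : 0 ≤ l := ge_of_tendsto' hl hu
  rcases hl0.eq_or_lt with h | h
  · rwa [← h] at hl
  exfalso
  obtain ⟨N, hN⟩ := eventually_atTop.1 (hl.eventually (lt_mem_nhds (half_lt_self h)))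
  -- Beyond `N` one has `u k > l / 2`, so apart from the first `N` weights the weighted sum
  -- dominates `l / 2` times the sum of the weights, which diverges.
  have key : ∀ n, l / 2 * ∑ k ∈ Finset.range n, α k
      ≤ C + l / 2 * ∑ k ∈ Finset.range N, α k := by
    intro n
    have h1 : ∑ k ∈ Finset.range n, α k * (l / 2)
        ≤ ∑ k ∈ Finset.range n, (α k * u k + if k < N then α k * (l / 2) else 0) := by
      refine Finset.sum_le_sum fun k _ => ?_
      split_ifs with hk
      · nlinarith [mul_nonneg (hα k) (hu k)]
      · nlinarith [hN k (not_lt.1 hk), hα k]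
    have h2 : ∑ k ∈ Finset.range n, (if k < N then α k * (l / 2) else 0)
        ≤ ∑ k ∈ Finset.range N, α k * (l / 2) := by
      rw [← Finset.sum_filter]
      refine Finset.sum_le_sum_of_subset_of_nonneg (fun k hk => ?_) fun k _ _ => ?_
      · simpa using (Finset.mem_filter.1 hk).2
      · exact mul_nonneg (hα k) (half_pos h).le
    rw [Finset.sum_add_distrib] at h1
    rw [← Finset.sum_mul] at h1 h2
    linarith [hC n, mul_comm (l / 2) (∑ k ∈ Finset.range n, α k),
      Finset.sum_mul (Finset.range N) α (l / 2)]
  obtain ⟨n, hn⟩ := (hαsum.eventually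
    (eventually_gt_atTop ((C + l / 2 * ∑ k ∈ Finset.range N, α k) / (l / 2)))).exists
  rw [div_lt_iff₀ (half_pos h)] at hn
  linarith [key n]

/-- A form of the Robbins-Siegmund theorem. -/
theorem ae_tendsto_zero_of_drift {Ω : Type*} [mΩ : MeasurableSpace Ω]
    {μ : Measure Ω} [IsFiniteMeasure μ] {ℱ : Filtration ℕ mΩ} {V : ℕ → Ω → ℝ}
    (hadp : StronglyAdapted ℱ V) (hint : ∀ k, Integrable (V k) μ) (h0 : ∀ k ω, 0 ≤ V k ω)
    {α : ℕ → ℝ} {c K : ℝ} (hc : 0 < c) (hK : 0 ≤ K) (hα : ∀ k, 0 ≤ α k)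
    (hαsum : Tendsto (fun n => ∑ k ∈ Finset.range n, α k) atTop atTop)
    (hαsq : Summable (fun k => α k ^ 2))
    (hdrift : ∀ k s, MeasurableSet[ℱ k] s → ∫ ω in s, V (k + 1) ω ∂μ ≤
      (1 + K * α k ^ 2 - c * α k) * ∫ ω in s, V k ω ∂μ + K * α k ^ 2 * μ.real s) :
    ∀ᵐ ω ∂μ, Tendsto (fun k => V k ω) atTop (𝓝 0) := by
  -- The discount `a` cancels the growth factors `1 + K α_k²`; summability of `α_k²` keeps it above
  -- a positive limit.
  set a : ℕ → ℝ := fun k => Real.exp (-(K * ∑ j ∈ Finset.range k, α j ^ 2)) with ha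
  have apos : ∀ k, 0 < a k := fun k => Real.exp_pos _
  have astep : ∀ k, a (k + 1) * (1 + K * α k ^ 2) ≤ a k := by
    intro k
    have : a k = a (k + 1) * Real.exp (K * α k ^ 2) := by
      simp only [ha, ← Real.exp_add, Finset.sum_range_succ]
      congr 1; ring
    rw [this]
    exact mul_le_mul_of_nonneg_left (by linarith [Real.add_one_le_exp (K * α k ^ 2)]) (apos _).le
  have alim : Tendsto a atTop (𝓝 (Real.exp (-(K * ∑' j, α j ^ 2)))) :=
    (Real.continuous_exp.tendsto _).comp (hαsq.hasSum.tendsto_sum_nat.const_mul K).neg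
  have alow : ∀ k, Real.exp (-(K * ∑' j, α j ^ 2)) ≤ a k := by
    intro k
    refine Real.exp_le_exp.2 (neg_le_neg (mul_le_mul_of_nonneg_left ?_ hK))
    exact hαsq.sum_le_tsum _ fun j _ => sq_nonneg _
  set e := Real.exp (-(K * ∑' j, α j ^ 2)) with he
  have epos : 0 < e := Real.exp_pos _
  -- Adding 1 absorbs the additive error: `(1 + K α²) V + K α² + 1 = (1 + K α²)(V + 1)`.
  set W : ℕ → Ω → ℝ := fun k ω => a k * (V k ω + 1) with hW
  -- The accumulated decrease of `W`. Both `W` and `W + T` are supermartingales: the first makes `V`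
  -- converge, the second bounds the sums of `α_j V_j`.
  set T : ℕ → Ω → ℝ := fun k ω => ∑ j ∈ Finset.range k, c * a (j + 1) * α j * V j ω with hT
  have hVm : ∀ i j, i ≤ j → StronglyMeasurable[ℱ j] (V i) := fun i j hij =>
    (hadp i).mono (ℱ.mono hij)
  have hTm : ∀ k, StronglyMeasurable[ℱ k] (T k) := by
    intro k
    refine Finset.stronglyMeasurable_fun_sum _ fun j hj => ?_
    exact (hVm j k (Finset.mem_range.1 hj).le).const_mul _
  have hTi : ∀ k, Integrable (T k) μ := fun k =>
    integrable_finsetSum _ fun j _ => (hint j).const_mul _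
  have hWi : ∀ k, Integrable (W k) μ := fun k =>
    ((hint k).add (integrable_const 1)).const_mul _
  have hWm : ∀ k, StronglyMeasurable[ℱ k] (W k) := fun k =>
    ((hadp k).add stronglyMeasurable_const).const_mul _
  have hT0 : ∀ k ω, 0 ≤ T k ω := fun k ω => Finset.sum_nonneg fun j _ =>
    mul_nonneg (mul_nonneg (mul_nonneg hc.le (apos _).le) (hα j)) (h0 j ω)
  have hW0 : ∀ k ω, 0 ≤ W k ω := fun k ω =>
    mul_nonneg (apos k).le (by linarith [h0 k ω])
  have hWint : ∀ k s, ∫ ω in s, W k ω ∂μ = a k * (∫ ω in s, V k ω ∂μ + μ.real s) := by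
    intro k s
    simp only [hW]
    rw [integral_const_mul, integral_add (hint k).integrableOn (integrable_const 1)]
    simp
  have hVs : ∀ k s, 0 ≤ ∫ ω in s, V k ω ∂μ := fun k s => integral_nonneg (h0 k)
  have hWstep : ∀ k s, MeasurableSet[ℱ k] s → ∫ ω in s, W (k + 1) ω ∂μ
      ≤ ∫ ω in s, W k ω ∂μ - c * a (k + 1) * α k * ∫ ω in s, V k ω ∂μ := by
    intro k s hs
    rw [hWint, hWint]
    have h1 := mul_le_mul_of_nonneg_left (hdrift k s hs) (apos (k + 1)).le
    have h2 := mul_le_mul_of_nonneg_right (astep k)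
      (add_nonneg (hVs k s) (measureReal_nonneg (μ := μ) (s := s)))
    nlinarith
  have supW : Supermartingale W ℱ μ := by
    refine supermartingale_of_setIntegral_succ_le hWm hWi fun k s hs => ?_
    have : 0 ≤ c * a (k + 1) * α k * ∫ ω in s, V k ω ∂μ :=
      mul_nonneg (mul_nonneg (mul_nonneg hc.le (apos _).le) (hα k)) (hVs k s)
    linarith [hWstep k s hs]
  have supY : Supermartingale (W + T) ℱ μ := by
    refine supermartingale_of_setIntegral_succ_le (fun k => (hWm k).add (hTm k))
      (fun k => (hWi k).add (hTi k)) fun k s hs => ?_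
    simp only [Pi.add_apply]
    rw [integral_add (hWi _).integrableOn (hTi _).integrableOn,
      integral_add (hWi _).integrableOn (hTi _).integrableOn]
    have : ∫ ω in s, T (k + 1) ω ∂μ
        = ∫ ω in s, T k ω ∂μ + c * a (k + 1) * α k * ∫ ω in s, V k ω ∂μ := by
      simp only [hT, Finset.sum_range_succ]
      rw [integral_add (hTi k).integrableOn ((hint k).const_mul _).integrableOn,
        integral_const_mul]
    rw [this]
    linarith [hWstep k s hs]
  filter_upwards [ae_exists_tendsto_of_supermartingale_nonneg supW hW0,
    ae_exists_tendsto_of_supermartingale_nonneg supY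
      fun k ω => add_nonneg (hW0 k ω) (hT0 k ω)] with ω ⟨l, hl⟩ ⟨l', hl'⟩
  have hVl : Tendsto (fun k => V k ω) atTop (𝓝 (l / e - 1)) := by
    have := (hl.div alim epos.ne').sub_const 1
    refine this.congr fun k => ?_
    change a k * (V k ω + 1) / a k - 1 = V k ω
    rw [mul_div_cancel_left₀ _ (apos k).ne']
    ring
  obtain ⟨C, hC⟩ := hl'.bddAbove_range
  refine tendsto_zero_of_weighted_sum_le (C := C / (c * e)) hα hαsum (fun k => h0 k ω) hVl
    fun n => ?_
  rw [le_div_iff₀ (mul_pos hc epos)]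
  have h1 : T n ω ≤ C := by
    have := hC ⟨n, rfl⟩
    simp only [Pi.add_apply] at this
    linarith [hW0 n ω]
  refine le_trans ?_ h1
  rw [Finset.sum_mul]
  refine Finset.sum_le_sum fun j _ => ?_
  have := mul_le_mul_of_nonneg_left (alow (j + 1)) (mul_nonneg hc.le (mul_nonneg (hα j) (h0 j ω)))
  nlinarith

/-- Averaging over an independent finitely valued variable. -/
theorem setIntegral_comp_eq_sum_of_indep {Ω T : Type*} [Fintype T] [MeasurableSpace T]
    [MeasurableSingletonClass T] {m mΩ : MeasurableSpace Ω} (hm : m ≤ mΩ)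
    {μ : Measure Ω} [IsFiniteMeasure μ] {Y : Ω → T} (hY : Measurable Y)
    (hind : Indep m (MeasurableSpace.comap Y inferInstance) μ)
    {f : T → Ω → ℝ} (hf : ∀ x, Measurable[m] (f x)) (hfi : ∀ x, Integrable (f x) μ)
    {s : Set Ω} (hs : MeasurableSet[m] s) :
    ∫ ω in s, f (Y ω) ω ∂μ = ∑ x, μ.real (Y ⁻¹' {x}) * ∫ ω in s, f x ω ∂μ := by
  classical
  have hYx : ∀ x, MeasurableSet (Y ⁻¹' {x}) := fun x => hY (measurableSet_singleton x)
  -- Splitting by the value of `Y` leaves products of an event of `Y` with an `m`-measurable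
  -- function, which factor by independence.
  have h1 : ∀ ω, s.indicator (fun ω => f (Y ω) ω) ω
      = ∑ x, (Y ⁻¹' {x}).indicator (fun _ => (1 : ℝ)) ω * s.indicator (f x) ω := by
    intro ω
    rw [Finset.sum_eq_single (Y ω)]
    · by_cases h : ω ∈ s <;> simp [h]
    · intro x _ hx
      simp [Set.indicator, Ne.symm hx]
    · simp
  have hsi : ∀ x, Integrable (s.indicator (f x)) μ := fun x => (hfi x).indicator (hm s hs)
  have hprod : ∀ x, ∫ ω, (Y ⁻¹' {x}).indicator (fun _ => (1 : ℝ)) ω * s.indicator (f x) ω ∂μ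
      = μ.real (Y ⁻¹' {x}) * ∫ ω in s, f x ω ∂μ := by
    intro x
    have hI : IndepFun ((Y ⁻¹' {x}).indicator fun _ => (1 : ℝ)) (s.indicator (f x)) μ := by
      rw [IndepFun_iff_Indep]
      refine indep_of_indep_of_le_left (indep_of_indep_of_le_right hind.symm ?_) ?_
      · exact ((hf x).indicator hs).comap_le
      · refine Measurable.comap_le ?_
        exact (measurable_const).indicator ⟨{x}, measurableSet_singleton x, rfl⟩
    rw [hI.integral_fun_mul_eq_mul_integral
      ((measurable_const.indicator (hYx x)).aestronglyMeasurable) (hsi x).aestronglyMeasurable,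
      integral_indicator_const _ (hYx x), integral_indicator (hm s hs)]
    simp
  rw [← integral_indicator (hm s hs)]
  simp_rw [h1]
  rw [integral_finsetSum]
  · exact Finset.sum_congr rfl fun x _ => hprod x
  · intro x _
    have : (fun ω => (Y ⁻¹' {x}).indicator (fun _ => (1 : ℝ)) ω * s.indicator (f x) ω)
        = (Y ⁻¹' {x}).indicator (s.indicator (f x)) := by
      ext ω; by_cases h : ω ∈ Y ⁻¹' {x} <;> simp [Set.indicator, h]
    rw [this]
    exact (hsi x).indicator (hYx x)

/-- The filtration generated by the observations strictly before time `k`. -/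
def pastFiltration {Ω T : Type*} [mΩ : MeasurableSpace Ω] [mT : MeasurableSpace T]
    (X : ℕ → Ω → T) (hX : ∀ k, Measurable (X k)) : Filtration ℕ mΩ where
  seq k := ⨆ i ∈ Set.Iio k, MeasurableSpace.comap (X i) mT
  mono' _ _ hij := biSup_mono fun _ h => lt_of_lt_of_le h hij
  le' _ := iSup₂_le fun i _ => (hX i).comap_le

/-- The state at time `k` depends only on inputs with index below `k`, so the fresh input may be
averaged with the state frozen. -/
theorem indep_pastFiltration {Ω T : Type*} [mΩ : MeasurableSpace Ω] [mT : MeasurableSpace T]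
    {μ : Measure Ω} {X : ℕ → Ω → T} (hX : ∀ k, Measurable (X k)) (hind : iIndepFun X μ) (k : ℕ) :
    Indep (pastFiltration X hX k) (MeasurableSpace.comap (X k) mT) μ := by
  have := indep_iSup_of_disjoint (fun i => (hX i).comap_le) hind.iIndep
    (S := Set.Iio k) (T := {k}) (by simp)
  simpa [pastFiltration] using this

/-- A recursion driven by i.i.d. finitely valued inputs, with a Lyapunov function of negative mean
drift. -/
theorem ae_tendsto_zero_of_lyapunov {Ω T Z : Type*} [mΩ : MeasurableSpace Ω] {μ : Measure Ω}
    [IsFiniteMeasure μ] [Fintype T] [MeasurableSpace T] [MeasurableSingletonClass T]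
    [MeasurableSpace Z] {X : ℕ → Ω → T} (hX : ∀ k, Measurable (X k)) (hind : iIndepFun X μ)
    {p : T → ℝ} (hp : ∀ k x, μ.real (X k ⁻¹' {x}) = p x)
    {F : ℕ → T → Z → Z} (hF : ∀ k x, Measurable (F k x)) {z : ℕ → Ω → Z} {z₀ : Z}
    (hz0 : ∀ ω, z 0 ω = z₀) (hz : ∀ k ω, z (k + 1) ω = F k (X k ω) (z k ω))
    {V : Z → ℝ} (hV : Measurable V) (hV0 : ∀ y, 0 ≤ V y)
    {α : ℕ → ℝ} {c K : ℝ} (hc : 0 < c) (hK : 0 ≤ K) (hα : ∀ k, 0 ≤ α k)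
    (hαsum : Tendsto (fun n => ∑ k ∈ Finset.range n, α k) atTop atTop)
    (hαsq : Summable (fun k => α k ^ 2))
    (hdrift : ∀ k y, ∑ x, p x * V (F k x y) ≤
      (1 + K * α k ^ 2 - c * α k) * V y + K * α k ^ 2) :
    ∀ᵐ ω ∂μ, Tendsto (fun k => V (z k ω)) atTop (𝓝 0) := by
  -- From a fixed start, finitely many input values give finitely many states at each time, so
  -- measurable functions of the state are bounded and integrable.
  have hfin : ∀ k, (Set.range (z k)).Finite := by
    intro k
    induction k with
    | zero => exact (Set.finite_singleton z₀).subset (by rintro _ ⟨ω, rfl⟩; exact hz0 ω)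
    | succ k ih =>
      refine (Set.Finite.image2 (F k) Set.finite_univ ih).subset ?_
      rintro _ ⟨ω, rfl⟩
      rw [hz]
      exact ⟨_, Set.mem_univ _, _, ⟨ω, rfl⟩, rfl⟩
  have hmeas : ∀ k, Measurable[pastFiltration X hX k] (z k) := by
    intro k
    induction k with
    | zero =>
      rw [show z 0 = fun _ => z₀ from funext hz0]
      exact measurable_const
    | succ k ih =>
      rw [show z (k + 1) = (fun q : T × Z => F k q.1 q.2) ∘ fun ω => (X k ω, z k ω) from
        funext (hz k)]
      have h1 : Measurable (fun q : T × Z => F k q.1 q.2) :=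
        measurable_from_prod_countable_right (hF k)
      refine h1.comp (Measurable.prodMk ?_ (ih.mono ((pastFiltration X hX).mono k.le_succ) le_rfl))
      refine Measurable.mono (comap_measurable (X k)) ?_ le_rfl
      exact le_biSup (fun i => MeasurableSpace.comap (X i) inferInstance) (Set.mem_Iio.2 k.lt_succ_self)
  have hint : ∀ (g : Z → ℝ) k, Measurable g → Integrable (fun ω => g (z k ω)) μ := by
    intro g k hg
    obtain ⟨C, hC⟩ := ((hfin k).image fun y => ‖g y‖).bddAbove
    refine Integrable.of_bound
      (hg.comp ((hmeas k).mono ((pastFiltration X hX).le k) le_rfl)).aestronglyMeasurable C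
      (Eventually.of_forall fun ω => hC ⟨_, ⟨ω, rfl⟩, rfl⟩)
  refine ae_tendsto_zero_of_drift (ℱ := pastFiltration X hX)
    (fun k => (hV.comp (hmeas k)).stronglyMeasurable) (fun k => hint V k hV)
    (fun k ω => hV0 _) hc hK hα hαsum hαsq fun k s hs => ?_
  have h1 : ∀ x, Measurable fun y => V (F k x y) := fun x => hV.comp (hF k x)
  simp_rw [hz]
  rw [setIntegral_comp_eq_sum_of_indep ((pastFiltration X hX).le k) (hX k)
    (indep_pastFiltration hX hind k) (f := fun x ω => V (F k x (z k ω)))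
    (fun x => (h1 x).comp (hmeas k)) (fun x => hint _ k (h1 x)) hs]
  simp_rw [hp, ← integral_const_mul]
  rw [← integral_finsetSum _ fun x _ => ((hint _ k (h1 x)).const_mul _).integrableOn]
  have h2 : K * α k ^ 2 * μ.real s = ∫ _ in s, K * α k ^ 2 ∂μ := by simp [mul_comm]
  rw [h2, ← integral_add ((hint V k hV).const_mul _).integrableOn (integrable_const _)]
  refine integral_mono ?_ ?_ fun ω => hdrift k _
  · exact integrable_finsetSum _ fun x _ => ((hint _ k (h1 x)).const_mul _).integrableOn
  · exact ((hint V k hV).const_mul _).integrableOn.add (integrable_const _)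

/-- A positive function that is homogeneous of degree two dominates all others. -/
theorem exists_le_mul_of_homogeneous {Z : Type*} [NormedAddCommGroup Z] [NormedSpace ℝ Z]
    [FiniteDimensional ℝ Z] {f g : Z → ℝ} (hf : Continuous f) (hg : Continuous g)
    (hfh : ∀ (t : ℝ) z, f (t • z) = t ^ 2 * f z) (hgh : ∀ (t : ℝ) z, g (t • z) = t ^ 2 * g z)
    (hpos : ∀ z, z ≠ 0 → 0 < f z) : ∃ K, 0 < K ∧ ∀ z, g z ≤ K * f z := by
  have hne : ∀ z ∈ Metric.sphere (0 : Z) 1, z ≠ 0 := fun z hz => ne_zero_of_mem_unit_sphere ⟨z, hz⟩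
  obtain ⟨C, hC⟩ := (isCompact_sphere (0 : Z) 1).bddAbove_image (f := fun z => g z / f z)
    (hg.continuousOn.div hf.continuousOn fun z hz => (hpos z (hne z hz)).ne')
  -- The maximum with 1 keeps the constant positive when `g` is not, or when the sphere is empty.
  refine ⟨max C 1, by positivity, fun z => ?_⟩
  rcases eq_or_ne z 0 with rfl | hz
  · have h1 := hfh 0 0
    have h2 := hgh 0 0
    simp only [smul_zero] at h1 h2
    norm_num at h1 h2
    simp [h1, h2]
  have hn : ‖z‖ ≠ 0 := norm_ne_zero_iff.2 hz
  have hu : ‖z‖⁻¹ • z ∈ Metric.sphere (0 : Z) 1 := by simp [norm_smul, hn]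
  have h1 : g (‖z‖⁻¹ • z) / f (‖z‖⁻¹ • z) ≤ max C 1 :=
    (hC ⟨_, hu, rfl⟩).trans (le_max_left _ _)
  rwa [div_le_iff₀ (hpos _ (hne _ hu)), hfh, hgh, mul_left_comm,
    mul_le_mul_iff_right₀ (by positivity)] at h1

/-- Almost sure convergence of linear stochastic approximation with i.i.d. finitely valued inputs,
when the mean field is dissipative for some inner product. -/
theorem ae_tendsto_of_linear_recursion {Ω T Z : Type*} [mΩ : MeasurableSpace Ω] {μ : Measure Ω}
    [IsFiniteMeasure μ] [Fintype T] [MeasurableSpace T] [MeasurableSingletonClass T]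
    [NormedAddCommGroup Z] [NormedSpace ℝ Z] [FiniteDimensional ℝ Z]
    [MeasurableSpace Z] [BorelSpace Z] {X : ℕ → Ω → T} (hX : ∀ k, Measurable (X k))
    (hind : iIndepFun X μ) {p : T → ℝ} (hp : ∀ k x, μ.real (X k ⁻¹' {x}) = p x)
    (hp1 : ∑ x, p x = 1)
    {G : T → Z →ₗ[ℝ] Z} {h : T → Z} {α : ℕ → ℝ} {z : ℕ → Ω → Z} {z₀ y₀ : Z}
    (hz0 : ∀ ω, z 0 ω = z₀)
    (hz : ∀ k ω, z (k + 1) ω = z k ω + α k • (G (X k ω) (z k ω - y₀) + h (X k ω)))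
    (hmean : ∑ x, p x • h x = 0)
    {Q : Z →ₗ[ℝ] Z →ₗ[ℝ] ℝ} (hsymm : ∀ u v, Q u v = Q v u) (hpos : ∀ u, u ≠ 0 → 0 < Q u u)
    (hneg : ∀ u, u ≠ 0 → Q u (∑ x, p x • G x u) < 0)
    (hα : ∀ k, 0 ≤ α k)
    (hαsum : Tendsto (fun n => ∑ k ∈ Finset.range n, α k) atTop atTop)
    (hαsq : Summable (fun k => α k ^ 2)) :
    ∀ᵐ ω ∂μ, Tendsto (fun k => z k ω) atTop (𝓝 y₀) := by
  have hp0 : ∀ x, 0 ≤ p x := fun x => hp 0 x ▸ measureReal_nonneg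
  have hGc : ∀ x, Continuous (G x) := fun x => (G x).continuous_of_finiteDimensional
  have hQc : Continuous fun w : Z × Z => Q w.1 w.2 :=
    (Q.toContinuousBilinearMap).continuous₂
  have hQcc : ∀ L : Z → Z, Continuous L → Continuous fun u => Q u (L u) := fun L hL =>
    hQc.comp (continuous_id.prodMk hL)
  have hQ0 : ∀ u, 0 ≤ Q u u := by
    intro u
    rcases eq_or_ne u 0 with rfl | hu
    · simp
    · exact (hpos u hu).le
  have hbar : Continuous fun u => Q u (∑ x, p x • G x u) :=
    hQcc _ (continuous_finsetSum _ fun x _ => (hGc x).const_smul (p x))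
  have hbarh : ∀ (t : ℝ) u, Q (t • u) (∑ x, p x • G x (t • u))
      = t ^ 2 * Q u (∑ x, p x • G x u) := by
    intro t u
    simp only [map_smul, LinearMap.smul_apply, map_sum, smul_eq_mul, Finset.mul_sum]
    exact Finset.sum_congr rfl fun x _ => by ring
  -- `K₁` turns strict dissipativity into a uniform rate, `K₂` bounds the second moment of the
  -- linear part by `Q`, and `K₃` compares the norm with `Q`.
  obtain ⟨K₁, hK₁, h1⟩ := exists_le_mul_of_homogeneous (f := fun u => -Q u (∑ x, p x • G x u))
    (g := fun u => Q u u) hbar.neg (hQcc _ continuous_id)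
    (fun t u => by simp only [hbarh]; ring) (fun t u => by simp; ring)
    (fun u hu => neg_pos.2 (hneg u hu))
  obtain ⟨K₂, hK₂, h2⟩ := exists_le_mul_of_homogeneous (f := fun u => Q u u)
    (g := fun u => ∑ x, p x * Q (G x u) (G x u)) (hQcc _ continuous_id)
    (continuous_finsetSum _ fun x _ => continuous_const.mul
      (hQc.comp ((hGc x).prodMk (hGc x)))) (fun t u => by simp; ring)
    (fun t u => by
      simp only [map_smul, LinearMap.smul_apply, smul_eq_mul, Finset.mul_sum]
      exact Finset.sum_congr rfl fun x _ => by ring) hpos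
  obtain ⟨K₃, hK₃, h3⟩ := exists_le_mul_of_homogeneous (f := fun u => Q u u)
    (g := fun u => ‖u‖ ^ 2) (hQcc _ continuous_id) (by fun_prop) (fun t u => by simp; ring)
    (fun t u => by rw [norm_smul, mul_pow, Real.norm_eq_abs, sq_abs]) hpos
  set H := ∑ x, p x * Q (h x) (h x) with hH
  have hH0 : 0 ≤ H := Finset.sum_nonneg fun x _ => mul_nonneg (hp0 x) (hQ0 _)
  have hdrift : ∀ k y, ∑ x, p x * Q (y + α k • (G x (y - y₀) + h x) - y₀)
        (y + α k • (G x (y - y₀) + h x) - y₀)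
      ≤ (1 + (2 * K₂ + 2 * H) * α k ^ 2 - 2 / K₁ * α k) * Q (y - y₀) (y - y₀)
        + (2 * K₂ + 2 * H) * α k ^ 2 := by
    intro k y
    set e := y - y₀ with he
    have e1 : ∀ x, p x * Q (y + α k • (G x e + h x) - y₀) (y + α k • (G x e + h x) - y₀)
        ≤ p x * Q e e + 2 * α k * (p x * Q e (G x e)) + 2 * α k * (p x * Q e (h x))
          + 2 * α k ^ 2 * (p x * Q (G x e) (G x e)) + 2 * α k ^ 2 * (p x * Q (h x) (h x)) := by
      intro x
      have : y + α k • (G x e + h x) - y₀ = e + α k • (G x e + h x) := by rw [he]; abel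
      rw [this]
      -- Nonnegativity of `Q` at `G x e - h x` gives `Q(g + h, g + h) ≤ 2 Q(g, g) + 2 Q(h, h)`, the
      -- source of the factors 2 in the drift constant.
      have h4 := mul_nonneg (mul_nonneg (hp0 x) (sq_nonneg (α k))) (hQ0 (G x e - h x))
      simp only [map_add, map_sub, map_smul, LinearMap.add_apply, LinearMap.sub_apply,
        LinearMap.smul_apply, smul_eq_mul] at h4 ⊢
      rw [hsymm (G x e) e, hsymm (h x) e, hsymm (h x) (G x e)] at *
      nlinarith
    refine (Finset.sum_le_sum fun x _ => e1 x).trans ?_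
    simp only [Finset.sum_add_distrib, ← Finset.mul_sum, ← Finset.sum_mul, hp1, one_mul, ← hH]
    have e2 : ∑ x, p x * Q e (h x) = 0 := by
      have := congrArg (Q e) hmean
      simpa [map_sum] using this
    have e3 : ∑ x, p x * Q e (G x e) = Q e (∑ x, p x • G x e) := by simp [map_sum]
    have e4 : ∑ x, p x * Q e (G x e) ≤ -(1 / K₁ * Q e e) := by
      have := h1 e
      rw [e3, le_neg, one_div, inv_mul_le_iff₀ hK₁]
      exact this
    have e5 := mul_le_mul_of_nonneg_left e4 (hα k)
    have e6 := mul_le_mul_of_nonneg_left (h2 e) (sq_nonneg (α k))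
    have e7 := mul_nonneg (mul_nonneg hH0 (sq_nonneg (α k))) (hQ0 e)
    have e8 := mul_nonneg hK₂.le (sq_nonneg (α k))
    rw [e2]
    have e9 : 2 / K₁ * α k * Q e e = 2 * (α k * (1 / K₁ * Q e e)) := by ring
    nlinarith
  have := ae_tendsto_zero_of_lyapunov (F := fun k x y => y + α k • (G x (y - y₀) + h x))
    (V := fun y => Q (y - y₀) (y - y₀)) (c := 2 / K₁) (K := 2 * K₂ + 2 * H) hX hind hp
    (fun k x => Continuous.measurable (by have := hGc x; fun_prop)) hz0 hz
    (hQc.comp (by fun_prop : Continuous fun y => (y - y₀, y - y₀))).measurable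
    (fun y => hQ0 _) (by positivity) (by positivity) hα hαsum hαsq hdrift
  filter_upwards [this] with ω hω
  rw [tendsto_iff_norm_sub_tendsto_zero]
  have hsq : Tendsto (fun k => ‖z k ω - y₀‖ ^ 2) atTop (𝓝 0) := by
    refine squeeze_zero (fun k => by positivity) (fun k => h3 _) ?_
    simpa using hω.const_mul K₃
  have := (Real.continuous_sqrt.tendsto 0).comp hsq
  simpa [Function.comp_def, Real.sqrt_sq] using this

end StochasticApproximation

/-! ### Saddle points of `L`, equilibria of the mean field and the Lyapunov form -/

section SaddlePoint

variable {q : ℕ}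

theorem dotProduct_mulVec_comm_of_isSymm {B : Matrix (Fin q) (Fin q) ℝ} (hB : B.IsSymm)
    (u v : Fin q → ℝ) : u ⬝ᵥ (B *ᵥ v) = v ⬝ᵥ (B *ᵥ u) := by
  rw [dotProduct_mulVec, ← mulVec_transpose, hB.eq, dotProduct_comm]

theorem dotProduct_transpose_mulVec (A : Matrix (Fin q) (Fin q) ℝ) (u v : Fin q → ℝ) :
    u ⬝ᵥ (Aᵀ *ᵥ v) = v ⬝ᵥ (A *ᵥ u) := by
  rw [dotProduct_mulVec, vecMul_transpose, dotProduct_comm]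

theorem dotProduct_mulVec_nonneg {B : Matrix (Fin q) (Fin q) ℝ}
    (hpos : ∀ v, v ≠ 0 → 0 < v ⬝ᵥ (B *ᵥ v)) (v : Fin q → ℝ) : 0 ≤ v ⬝ᵥ (B *ᵥ v) := by
  rcases eq_or_ne v 0 with rfl | hv
  · simp
  · exact (hpos v hv).le

theorem eq_zero_of_forall_mul_le_sq_mul {a c : ℝ} (h : ∀ t : ℝ, t * a ≤ t ^ 2 * c) : a = 0 := by
  by_contra ha
  -- A step small enough for the linear term to beat the quadratic one.
  have h1 := h (a / (2 * (|c| + 1)))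
  have hc : c < |c| + 1 := by linarith [le_abs_self c]
  have hpos : 0 < |c| + 1 := by positivity
  have ha2 : 0 < a ^ 2 := by positivity
  have e1 : a / (2 * (|c| + 1)) * a = a ^ 2 / (|c| + 1) ^ 2 * ((|c| + 1) / 2) := by
    field_simp
  have e2 : (a / (2 * (|c| + 1))) ^ 2 * c = a ^ 2 / (|c| + 1) ^ 2 * (c / 4) := by
    field_simp; ring
  rw [e1, e2] at h1
  have := le_of_mul_le_mul_left h1 (by positivity)
  linarith

/-- The saddle points of a quadratic function, convex in the first and concave in the second
argument, are its critical points. -/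
theorem isSaddlePoint_iff {A B : Matrix (Fin q) (Fin q) ℝ} {b : Fin q → ℝ} {σ : ℝ} (hσ : 0 ≤ σ)
    (hB : B.IsSymm) (hpos : ∀ v, v ≠ 0 → 0 < v ⬝ᵥ (B *ᵥ v)) (p : (Fin q → ℝ) × (Fin q → ℝ)) :
    IsSaddlePoint (fun θ w => σ / 2 * (θ ⬝ᵥ (B *ᵥ θ)) + w ⬝ᵥ (b + A *ᵥ θ)
      - 1 / 2 * (w ⬝ᵥ (B *ᵥ w))) p ↔
    σ • B *ᵥ p.1 + Aᵀ *ᵥ p.2 = 0 ∧ b + A *ᵥ p.1 = B *ᵥ p.2 := by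
  obtain ⟨θ, w⟩ := p
  -- Exact second-order expansions in each variable; the linear coefficients are the partial
  -- gradients.
  have hw : ∀ v, (σ / 2 * (θ ⬝ᵥ (B *ᵥ θ)) + (w + v) ⬝ᵥ (b + A *ᵥ θ)
      - 1 / 2 * ((w + v) ⬝ᵥ (B *ᵥ (w + v)))) = (σ / 2 * (θ ⬝ᵥ (B *ᵥ θ)) + w ⬝ᵥ (b + A *ᵥ θ)
      - 1 / 2 * (w ⬝ᵥ (B *ᵥ w))) + v ⬝ᵥ (b + A *ᵥ θ - B *ᵥ w) - 1 / 2 * (v ⬝ᵥ (B *ᵥ v)) := by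
    intro v
    simp only [mulVec_add, add_dotProduct, dotProduct_add, dotProduct_sub]
    rw [dotProduct_mulVec_comm_of_isSymm hB w v]
    ring
  have hθ : ∀ v, (σ / 2 * ((θ + v) ⬝ᵥ (B *ᵥ (θ + v))) + w ⬝ᵥ (b + A *ᵥ (θ + v))
      - 1 / 2 * (w ⬝ᵥ (B *ᵥ w))) = (σ / 2 * (θ ⬝ᵥ (B *ᵥ θ)) + w ⬝ᵥ (b + A *ᵥ θ)
      - 1 / 2 * (w ⬝ᵥ (B *ᵥ w))) + v ⬝ᵥ (σ • B *ᵥ θ + Aᵀ *ᵥ w) + σ / 2 * (v ⬝ᵥ (B *ᵥ v)) := by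
    intro v
    simp only [mulVec_add, add_dotProduct, dotProduct_add, dotProduct_smul,
      smul_eq_mul, dotProduct_transpose_mulVec]
    rw [dotProduct_mulVec_comm_of_isSymm hB θ v]
    ring
  simp only [IsSaddlePoint]
  constructor
  · intro h
    constructor
    · rw [← dotProduct_self_eq_zero, ← neg_eq_zero]
      -- Perturbing along the gradient itself, extremality bounds its squared length to first order
      -- by a second-order term.
      refine eq_zero_of_forall_mul_le_sq_mul (c := σ / 2 *
        ((σ • B *ᵥ θ + Aᵀ *ᵥ w) ⬝ᵥ (B *ᵥ (σ • B *ᵥ θ + Aᵀ *ᵥ w)))) fun t => ?_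
      have h1 := (h (θ + t • (σ • B *ᵥ θ + Aᵀ *ᵥ w)) w).2
      rw [hθ] at h1
      rw [mulVec_smul, smul_dotProduct, smul_dotProduct, dotProduct_smul] at h1
      simp only [smul_eq_mul] at h1
      linarith
    · rw [← sub_eq_zero, ← dotProduct_self_eq_zero]
      refine eq_zero_of_forall_mul_le_sq_mul (c := 1 / 2 *
        ((b + A *ᵥ θ - B *ᵥ w) ⬝ᵥ (B *ᵥ (b + A *ᵥ θ - B *ᵥ w)))) fun t => ?_
      have h1 := (h θ (w + t • (b + A *ᵥ θ - B *ᵥ w))).1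
      rw [hw] at h1
      rw [mulVec_smul, smul_dotProduct, smul_dotProduct, dotProduct_smul] at h1
      simp only [smul_eq_mul] at h1
      linarith
  · rintro ⟨h1, h2⟩ θ' w'
    constructor
    · have := hw (w' - w)
      rw [add_sub_cancel, h2, sub_self, dotProduct_zero] at this
      rw [h2, this]
      linarith [dotProduct_mulVec_nonneg hpos (w' - w)]
    · have := hθ (θ' - θ)
      rw [add_sub_cancel, h1, dotProduct_zero] at this
      rw [this]
      linarith [mul_nonneg hσ (dotProduct_mulVec_nonneg hpos (θ' - θ))]

theorem eq_zero_of_isUnit_of_mulVec_eq_zero {A : Matrix (Fin q) (Fin q) ℝ} (hA : IsUnit A)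
    {v : Fin q → ℝ} (h : A *ᵥ v = 0) : v = 0 :=
  (mulVec_injective_iff_isUnit.2 hA) (by simpa using h)

theorem isUnit_of_forall_mulVec_eq_zero {A : Matrix (Fin q) (Fin q) ℝ}
    (h : ∀ v, A *ᵥ v = 0 → v = 0) : IsUnit A :=
  mulVec_injective_iff_isUnit.1
    ((injective_iff_map_eq_zero A.mulVecLin).2 fun v hv => h v (by simpa using hv))

/-- The critical point equations have at most one solution. -/
theorem critical_point_unique {A B : Matrix (Fin q) (Fin q) ℝ} {b : Fin q → ℝ} {σ : ℝ}
    (hσ : 0 ≤ σ) (hA : σ = 0 → IsUnit A)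
    (hpos : ∀ v, v ≠ 0 → 0 < v ⬝ᵥ (B *ᵥ v)) {p p' : (Fin q → ℝ) × (Fin q → ℝ)}
    (h : σ • B *ᵥ p.1 + Aᵀ *ᵥ p.2 = 0 ∧ b + A *ᵥ p.1 = B *ᵥ p.2)
    (h' : σ • B *ᵥ p'.1 + Aᵀ *ᵥ p'.2 = 0 ∧ b + A *ᵥ p'.1 = B *ᵥ p'.2) : p' = p := by
  set x := p'.1 - p.1 with hx
  set y := p'.2 - p.2 with hy
  have e1 : σ • B *ᵥ x + Aᵀ *ᵥ y = 0 := by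
    have := congrArg₂ (· - ·) h'.1 h.1
    simp only [sub_self] at this
    rw [← this, hx, hy, mulVec_sub, mulVec_sub, smul_sub]
    abel
  have e2 : A *ᵥ x = B *ᵥ y := by
    rw [hx, hy, mulVec_sub, mulVec_sub, ← h.2, ← h'.2]
    abel
  -- Pair the first difference equation with `x`: the cross term `x ⬝ᵥ Aᵀ y` equals `y ⬝ᵥ A x`,
  -- which is `y ⬝ᵥ B y` by the second.
  have e3 : σ * (x ⬝ᵥ (B *ᵥ x)) + y ⬝ᵥ (B *ᵥ y) = 0 := by
    have := congrArg (fun u => x ⬝ᵥ u) e1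
    simpa [dotProduct_add, smul_mulVec, dotProduct_transpose_mulVec, e2] using this
  have e4 := mul_nonneg hσ (dotProduct_mulVec_nonneg hpos x)
  have hy0 : y = 0 := by
    by_contra hne
    linarith [hpos y hne]
  have hx0 : x = 0 := by
    rcases hσ.eq_or_lt with h0 | h0
    · exact eq_zero_of_isUnit_of_mulVec_eq_zero (hA h0.symm) (by simp [e2, hy0])
    · by_contra hne
      have := mul_pos h0 (hpos x hne)
      linarith [dotProduct_mulVec_nonneg hpos y]
  exact Prod.ext (sub_eq_zero.1 hx0) (sub_eq_zero.1 hy0)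

/-- The linear part `(θ, w) ↦ (-Aᵀ w - B θ, A θ - σ B w)` of the mean field. -/
def meanField (A B : Matrix (Fin q) (Fin q) ℝ) (σ : ℝ) :
    (Fin q → ℝ) × (Fin q → ℝ) →ₗ[ℝ] (Fin q → ℝ) × (Fin q → ℝ) where
  toFun u := (-(Aᵀ *ᵥ u.2) - B *ᵥ u.1, A *ᵥ u.1 - σ • (B *ᵥ u.2))
  map_add' u v := by
    ext1 <;> simp only [Prod.fst_add, Prod.snd_add, mulVec_add, smul_add] <;> abel
  map_smul' t u := by
    ext1 <;> simp [mulVec_smul, smul_sub, smul_comm t σ]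

/-- The bilinear form `⟪θ, θ'⟫ + ⟪w, w'⟫ + ε (⟪θ, Aᵀ w'⟫ + ⟪θ', Aᵀ w⟫)`. -/
def lyapunovForm (A : Matrix (Fin q) (Fin q) ℝ) (ε : ℝ) :
    (Fin q → ℝ) × (Fin q → ℝ) →ₗ[ℝ] (Fin q → ℝ) × (Fin q → ℝ) →ₗ[ℝ] ℝ :=
  LinearMap.mk₂ ℝ (fun u v => u.1 ⬝ᵥ v.1 + u.2 ⬝ᵥ v.2
      + ε * (u.1 ⬝ᵥ (Aᵀ *ᵥ v.2) + v.1 ⬝ᵥ (Aᵀ *ᵥ u.2)))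
    (fun u u' v => by simp [mulVec_add]; ring)
    (fun t u v => by simp [mulVec_smul]; ring)
    (fun u v v' => by simp [mulVec_add]; ring)
    (fun t u v => by simp [mulVec_smul]; ring)

theorem lyapunovForm_apply (A : Matrix (Fin q) (Fin q) ℝ) (ε : ℝ)
    (u v : (Fin q → ℝ) × (Fin q → ℝ)) : lyapunovForm A ε u v = u.1 ⬝ᵥ v.1 + u.2 ⬝ᵥ v.2
      + ε * (u.1 ⬝ᵥ (Aᵀ *ᵥ v.2) + v.1 ⬝ᵥ (Aᵀ *ᵥ u.2)) := rfl

theorem lyapunovForm_comm (A : Matrix (Fin q) (Fin q) ℝ) (ε : ℝ)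
    (u v : (Fin q → ℝ) × (Fin q → ℝ)) : lyapunovForm A ε u v = lyapunovForm A ε v u := by
  simp only [lyapunovForm_apply, dotProduct_comm u.1 v.1, dotProduct_comm u.2 v.2]
  ring

/-- At order zero in `ε` the skew coupling through `A` and `Aᵀ` cancels. The order-one part contains
`-‖Aᵀ w‖²`, the only source of decay in `w` when `σ = 0`. -/
theorem lyapunovForm_meanField (A B : Matrix (Fin q) (Fin q) ℝ) (σ ε : ℝ)
    (u : (Fin q → ℝ) × (Fin q → ℝ)) : lyapunovForm A ε u (meanField A B σ u)
      = -(u.1 ⬝ᵥ (B *ᵥ u.1)) - σ * (u.2 ⬝ᵥ (B *ᵥ u.2))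
        + ε * ((A *ᵥ u.1) ⬝ᵥ (A *ᵥ u.1) - σ * (u.1 ⬝ᵥ (Aᵀ *ᵥ (B *ᵥ u.2)))
          - (Aᵀ *ᵥ u.2) ⬝ᵥ (Aᵀ *ᵥ u.2) - (B *ᵥ u.1) ⬝ᵥ (Aᵀ *ᵥ u.2)) := by
  have h1 : u.1 ⬝ᵥ (Aᵀ *ᵥ (A *ᵥ u.1)) = (A *ᵥ u.1) ⬝ᵥ (A *ᵥ u.1) :=
    dotProduct_transpose_mulVec ..
  have h2 : u.2 ⬝ᵥ (A *ᵥ u.1) = u.1 ⬝ᵥ (Aᵀ *ᵥ u.2) := (dotProduct_transpose_mulVec ..).symm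
  simp only [lyapunovForm_apply, meanField, LinearMap.coe_mk, AddHom.coe_mk, dotProduct_sub,
    dotProduct_neg, dotProduct_smul, mulVec_sub, mulVec_smul, sub_dotProduct, neg_dotProduct,
    smul_eq_mul, h1, h2]
  ring

/-- Some inner product makes the mean field dissipative. -/
theorem exists_lyapunovForm {A B : Matrix (Fin q) (Fin q) ℝ} {σ : ℝ}
    (hσ : 0 ≤ σ) (hA : σ = 0 → IsUnit A)
    (hpos : ∀ v, v ≠ 0 → 0 < v ⬝ᵥ (B *ᵥ v)) :
    ∃ ε, (∀ u, u ≠ 0 → 0 < lyapunovForm A ε u u) ∧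
      ∀ u, u ≠ 0 → lyapunovForm A ε u (meanField A B σ u) < 0 := by
  have hsq : ∀ v : Fin q → ℝ, 0 ≤ v ⬝ᵥ v := fun v =>
    Finset.sum_nonneg fun i _ => mul_self_nonneg (v i)
  have hsqpos : ∀ v : Fin q → ℝ, v ≠ 0 → 0 < v ⬝ᵥ v := fun v hv =>
    (hsq v).lt_of_ne' (mt dotProduct_self_eq_zero.1 hv)
  have hne : ∀ u : (Fin q → ℝ) × (Fin q → ℝ), u ≠ 0 → u.1 ≠ 0 ∨ u.2 ≠ 0 := by
    intro u hu
    by_contra! h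
    exact hu (Prod.ext h.1 h.2)
  have hBn := dotProduct_mulVec_nonneg hpos
  rcases hσ.eq_or_lt with h0 | h0
  · have hU := hA h0.symm
    have hUt : IsUnit Aᵀ := (isUnit_transpose A).2 hU
    obtain ⟨K, hK, h1⟩ := exists_le_mul_of_homogeneous (f := fun v : Fin q → ℝ => v ⬝ᵥ (B *ᵥ v))
      (g := fun v => (A *ᵥ v) ⬝ᵥ (A *ᵥ v) + 1 / 2 * ((B *ᵥ v) ⬝ᵥ (B *ᵥ v)))
      (by fun_prop) (by fun_prop) (fun t v => by simp [mulVec_smul]; ring)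
      (fun t v => by simp [mulVec_smul]; ring) hpos
    obtain ⟨K', hK', h2⟩ := exists_le_mul_of_homogeneous (f := fun v : Fin q → ℝ => v ⬝ᵥ v)
      (g := fun v => (Aᵀ *ᵥ v) ⬝ᵥ (Aᵀ *ᵥ v))
      (by fun_prop) (by fun_prop) (fun t v => by simp; ring)
      (fun t v => by simp [mulVec_smul]; ring) hsqpos
    -- This makes `ε`, `ε K` and `ε K'` all at most 1/2: half of the Euclidean square survives in
    -- the form, and half of `θᵀ B θ` plus `ε / 2 ‖Aᵀ w‖²` in the decay.
    set ε := 1 / (2 * (K + K' + 1)) with hε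
    have hε0 : 0 < ε := by positivity
    have hε1 : ε * (K + K' + 1) = 1 / 2 := by rw [hε]; field_simp
    have hεK : 0 < ε * K := by positivity
    have hεK' : 0 < ε * K' := by positivity
    have young : ∀ v w : Fin q → ℝ, |v ⬝ᵥ w| ≤ 1 / 2 * (v ⬝ᵥ v) + 1 / 2 * (w ⬝ᵥ w) := by
      intro v w
      have e1 := hsq (v + w)
      have e2 := hsq (v - w)
      simp only [add_dotProduct, dotProduct_add, sub_dotProduct, dotProduct_sub,
        dotProduct_comm w v] at e1 e2
      rw [abs_le]
      constructor <;> linarith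
    refine ⟨ε, fun u hu => ?_, fun u hu => ?_⟩
    · rw [lyapunovForm_apply]
      have e1 := (abs_le.1 (young u.1 (Aᵀ *ᵥ u.2))).1
      have e2 := h2 u.2
      have e3 := mul_le_mul_of_nonneg_left e1 hε0.le
      have e4 := mul_le_mul_of_nonneg_left e2 hε0.le
      have e5 : ε * (u.1 ⬝ᵥ u.1) ≤ 1 / 2 * (u.1 ⬝ᵥ u.1) :=
        mul_le_mul_of_nonneg_right (by linarith) (hsq _)
      have e6 : ε * K' * (u.2 ⬝ᵥ u.2) ≤ 1 / 2 * (u.2 ⬝ᵥ u.2) :=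
        mul_le_mul_of_nonneg_right (by linarith) (hsq _)
      have e7 : 0 < u.1 ⬝ᵥ u.1 + u.2 ⬝ᵥ u.2 := by
        rcases hne u hu with h | h
        · linarith [hsqpos _ h, hsq u.2]
        · linarith [hsqpos _ h, hsq u.1]
      nlinarith
    · rw [lyapunovForm_meanField, ← h0]
      have e1 := (abs_le.1 (young (B *ᵥ u.1) (Aᵀ *ᵥ u.2))).1
      have e2 := mul_le_mul_of_nonneg_left e1 hε0.le
      have e3 := mul_le_mul_of_nonneg_left (h1 u.1) hε0.le
      have e4 : ε * K * (u.1 ⬝ᵥ (B *ᵥ u.1)) ≤ 1 / 2 * (u.1 ⬝ᵥ (B *ᵥ u.1)) :=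
        mul_le_mul_of_nonneg_right (by linarith) (hBn _)
      have e5 : 0 < 1 / 2 * (u.1 ⬝ᵥ (B *ᵥ u.1))
          + ε * (1 / 2 * ((Aᵀ *ᵥ u.2) ⬝ᵥ (Aᵀ *ᵥ u.2))) := by
        have e6 := hBn u.1
        have e7 := hsq (Aᵀ *ᵥ u.2)
        rcases hne u hu with h | h
        · have := hpos _ h
          positivity
        · have := hsqpos (Aᵀ *ᵥ u.2) (mt (eq_zero_of_isUnit_of_mulVec_eq_zero hUt) h)
          positivity
      nlinarith
  · refine ⟨0, fun u hu => ?_, fun u hu => ?_⟩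
    · rw [lyapunovForm_apply]
      rcases hne u hu with h | h
      · linarith [hsqpos _ h, hsq u.2]
      · linarith [hsqpos _ h, hsq u.1]
    · rw [lyapunovForm_meanField]
      rcases hne u hu with h | h
      · linarith [hpos _ h, mul_nonneg hσ (hBn u.2)]
      · linarith [mul_pos h0 (hpos _ h), hBn u.1]

/-- A kernel vector would have zero drift, against strict dissipativity; in finite dimension
injectivity gives surjectivity. -/
theorem exists_meanField_eq {A B : Matrix (Fin q) (Fin q) ℝ} {σ : ℝ}
    (hσ : 0 ≤ σ) (hA : σ = 0 → IsUnit A) (hpos : ∀ v, v ≠ 0 → 0 < v ⬝ᵥ (B *ᵥ v))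
    (v : (Fin q → ℝ) × (Fin q → ℝ)) : ∃ u, meanField A B σ u = v := by
  obtain ⟨ε, -, hneg⟩ := exists_lyapunovForm hσ hA hpos
  refine LinearMap.surjective_of_injective ((injective_iff_map_eq_zero _).2 fun u hu => ?_) v
  by_contra hne
  simpa [hu] using hneg u hne

/-- Elimination of the second variable from the equilibrium equations. -/
theorem equilibrium_fst_eq {A B : Matrix (Fin q) (Fin q) ℝ} {b : Fin q → ℝ} {σ : ℝ}
    (hσ : 0 ≤ σ) (hU : IsUnit A) (hpos : ∀ v, v ≠ 0 → 0 < v ⬝ᵥ (B *ᵥ v))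
    {u : (Fin q → ℝ) × (Fin q → ℝ)} (hu : meanField A B σ u = -(0, b)) :
    IsUnit (A + σ • (B * Aᵀ⁻¹ * B)) ∧ u.1 = -((A + σ • (B * Aᵀ⁻¹ * B))⁻¹ *ᵥ b) := by
  have hdet : IsUnit Aᵀ.det := (isUnit_iff_isUnit_det _).1 ((isUnit_transpose A).2 hU)
  have hBn := dotProduct_mulVec_nonneg hpos
  have hunit : IsUnit (A + σ • (B * Aᵀ⁻¹ * B)) := by
    refine isUnit_of_forall_mulVec_eq_zero fun x hx => ?_
    set y := Aᵀ⁻¹ *ᵥ (B *ᵥ x) with hy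
    have h1 : Aᵀ *ᵥ y = B *ᵥ x := by
      rw [hy, mulVec_mulVec, mul_nonsing_inv _ hdet, one_mulVec]
    have h2 : A *ᵥ x + σ • (B *ᵥ y) = 0 := by
      rw [← hx, add_mulVec, smul_mulVec, hy, mulVec_mulVec, mulVec_mulVec, Matrix.mul_assoc]
    -- Pair the kernel equation with `y`: since `Aᵀ y = B x`, the term `y ⬝ᵥ A x` becomes `x ⬝ᵥ B
    -- x`, leaving a sum of nonnegative terms.
    have h3 : x ⬝ᵥ (B *ᵥ x) + σ * (y ⬝ᵥ (B *ᵥ y)) = 0 := by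
      have := congrArg (fun v => y ⬝ᵥ v) h2
      rw [← h1, dotProduct_transpose_mulVec]
      simpa [dotProduct_add] using this
    by_contra hne
    linarith [hpos x hne, mul_nonneg hσ (hBn y)]
  refine ⟨hunit, ?_⟩
  have h1 : -(Aᵀ *ᵥ u.2) - B *ᵥ u.1 = 0 := by simpa [meanField] using congrArg Prod.fst hu
  have h2 : A *ᵥ u.1 - σ • (B *ᵥ u.2) = -b := by simpa [meanField] using congrArg Prod.snd hu
  have h3 : u.2 = -(Aᵀ⁻¹ *ᵥ (B *ᵥ u.1)) := by
    rw [← mulVec_neg, ← (neg_eq_iff_eq_neg.1 (by rw [← sub_eq_zero, ← h1] :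
      -(Aᵀ *ᵥ u.2) = B *ᵥ u.1)), mulVec_mulVec, nonsing_inv_mul _ hdet, one_mulVec]
  have h4 : (A + σ • (B * Aᵀ⁻¹ * B)) *ᵥ u.1 = -b := by
    rw [← h2, h3, add_mulVec, smul_mulVec, mulVec_neg, mulVec_mulVec, mulVec_mulVec,
      Matrix.mul_assoc]
    simp
  rw [← mulVec_neg, ← h4, mulVec_mulVec,
    nonsing_inv_mul _ ((isUnit_iff_isUnit_det _).1 hunit), one_mulVec]

end SaddlePoint

/-! ### Averages of the GTD4 update over one transition -/

section MeanUpdate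

variable {S A : Type*} [Fintype S] [Fintype A] {q : ℕ}

/-- The probability of the transition `x = (s, a, s')`. -/
def sampleProb (M : MDP S A) (β : Policy S A) (d : S → ℝ) (x : S × A × S) : ℝ :=
  d x.1 * β.prob x.1 x.2.1 * M.P x.1 x.2.1 x.2.2

theorem sum_sampleProb_mul (M : MDP S A) (β : Policy S A) (d f : S → ℝ) :
    ∑ x, sampleProb M β d x * f x.1 = ∑ s, d s * f s := by
  simp only [Fintype.sum_prod_type, sampleProb]
  refine Finset.sum_congr rfl fun s _ => ?_
  simp only [← Finset.sum_mul, ← Finset.mul_sum, M.P_sum, mul_one, β.sum_eq_one]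

/-- Importance sampling changes the action law from `β` to `π` while the state weights stay `d`.
Where `β` vanishes, coverage makes both sides zero, whatever value the ratio takes. -/
theorem sampleProb_mul_impRatio (M : MDP S A) {π β : Policy S A}
    (hcover : ∀ s a, β.prob s a = 0 → π.prob s a = 0) (d : S → ℝ) (x : S × A × S) :
    sampleProb M β d x * impRatio π β x.1 x.2.1 = sampleProb M π d x := by
  rw [sampleProb, sampleProb, impRatio]
  rcases eq_or_ne (β.prob x.1 x.2.1) 0 with h | h
  · simp [h, hcover _ _ h]
  · field_simp

theorem sum_sampleProb_mul_snd (M : MDP S A) (π : Policy S A) (d : S → ℝ) (f : S → S → ℝ) :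
    ∑ x, sampleProb M π d x * f x.1 x.2.2 = ∑ s, d s * ∑ s', M.transMatrix π s s' * f s s' := by
  simp only [Fintype.sum_prod_type, sampleProb, MDP.transMatrix, of_apply, Finset.sum_mul,
    Finset.mul_sum]
  refine Finset.sum_congr rfl fun s _ => ?_
  rw [Finset.sum_comm]
  exact Finset.sum_congr rfl fun _ _ => Finset.sum_congr rfl fun _ _ => by ring

theorem sum_sampleProb_mul_reward (M : MDP S A) (π : Policy S A) (d f : S → ℝ) :
    ∑ x, sampleProb M π d x * (M.r x.1 x.2.1 x.2.2 * f x.1)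
      = ∑ s, d s * (M.expReward π s * f s) := by
  simp only [Fintype.sum_prod_type, sampleProb, MDP.expReward, Finset.sum_mul, Finset.mul_sum]
  exact Finset.sum_congr rfl fun _ _ => Finset.sum_congr rfl fun _ _ =>
    Finset.sum_congr rfl fun _ _ => by ring

/-- The linear part of the GTD4 update direction for the transition `x`. -/
noncomputable def updateLinear (M : MDP S A) (π β : Policy S A) (Φ : Matrix S (Fin q) ℝ) (σ : ℝ)
    (x : S × A × S) : (Fin q → ℝ) × (Fin q → ℝ) →ₗ[ℝ] (Fin q → ℝ) × (Fin q → ℝ) where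
  toFun u := ((Φ x.1 ⬝ᵥ u.2) • (Φ x.1 - (M.γ * impRatio π β x.1 x.2.1) • Φ x.2.2)
      - (Φ x.1 ⬝ᵥ u.1) • Φ x.1,
    (M.γ * impRatio π β x.1 x.2.1 * (Φ x.2.2 ⬝ᵥ u.1) - Φ x.1 ⬝ᵥ u.1 - σ * (Φ x.1 ⬝ᵥ u.2)) • Φ x.1)
  map_add' u v := by
    ext1
    · simp only [Prod.fst_add, Prod.snd_add, dotProduct_add, add_smul]; abel
    · simp only [Prod.fst_add, Prod.snd_add, dotProduct_add, ← add_smul]; congr 1; ring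
  map_smul' t u := by
    ext1
    · simp only [Prod.smul_fst, Prod.smul_snd, dotProduct_smul, smul_eq_mul, mul_smul, smul_sub,
        RingHom.id_apply]
    · simp only [Prod.smul_fst, Prod.smul_snd, dotProduct_smul, smul_eq_mul, smul_smul,
        RingHom.id_apply]; congr 1; ring

/-- The constant part of the GTD4 update direction for the transition `x`. -/
noncomputable def updateConst (M : MDP S A) (π β : Policy S A) (Φ : Matrix S (Fin q) ℝ)
    (x : S × A × S) : (Fin q → ℝ) × (Fin q → ℝ) :=
  (0, (impRatio π β x.1 x.2.1 * M.r x.1 x.2.1 x.2.2) • Φ x.1)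

theorem gtd4_succ (M : MDP S A) (π β : Policy S A) (Φ : Matrix S (Fin q) ℝ) (σ : ℝ)
    (α : ℕ → ℝ) (z₀ : (Fin q → ℝ) × (Fin q → ℝ)) (x : ℕ → S × A × S) (k : ℕ) :
    gtd4 M π β Φ σ α z₀ x (k + 1) = gtd4 M π β Φ σ α z₀ x k
      + α k • (updateLinear M π β Φ σ (x k) (gtd4 M π β Φ σ α z₀ x k)
        + updateConst M π β Φ (x k)) := by
  rw [gtd4]
  ext1
  · simp [updateLinear, updateConst]
  · simp only [updateLinear, updateConst, tdError, Prod.snd_add, Prod.smul_snd, LinearMap.coe_mk,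
      AddHom.coe_mk, ← add_smul]
    congr 3
    ring

theorem transMatrix_nonneg (M : MDP S A) (π : Policy S A) (s s' : S) :
    0 ≤ M.transMatrix π s s' :=
  Finset.sum_nonneg fun a _ => mul_nonneg (M.P_nonneg s a s') (π.nonneg s a)

theorem sum_transMatrix (M : MDP S A) (π : Policy S A) (s : S) :
    ∑ s', M.transMatrix π s s' = 1 := by
  simp only [MDP.transMatrix, of_apply]
  rw [Finset.sum_comm]
  simp only [← Finset.sum_mul, M.P_sum, one_mul, π.sum_eq_one]

theorem mulVec_ne_zero_of_rank_eq {m : Type*} {Φ : Matrix m (Fin q) ℝ} (hΦ : Φ.rank = q)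
    {v : Fin q → ℝ} (hv : v ≠ 0) : Φ *ᵥ v ≠ 0 := by
  have h := Φ.mulVecLin.finrank_range_add_finrank_ker
  rw [← Matrix.rank, hΦ, Module.finrank_fin_fun] at h
  have hker : LinearMap.ker Φ.mulVecLin = ⊥ := Submodule.finrank_eq_zero.1 (by omega)
  intro h0
  have : v ∈ LinearMap.ker Φ.mulVecLin := by simpa using h0
  rw [hker] at this
  exact hv (by simpa using this)

theorem sum_mul_sq_pos {d : S → ℝ} (hd : ∀ s, 0 < d s) {Φ : Matrix S (Fin q) ℝ}
    (hΦ : Φ.rank = q) {v : Fin q → ℝ} (hv : v ≠ 0) : 0 < ∑ s, d s * (Φ s ⬝ᵥ v) ^ 2 := by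
  obtain ⟨s, hs⟩ := Function.ne_iff.1 (mulVec_ne_zero_of_rank_eq hΦ hv)
  refine Finset.sum_pos' (fun s _ => mul_nonneg (hd s).le (sq_nonneg _)) ⟨s, Finset.mem_univ _, ?_⟩
  have : Φ s ⬝ᵥ v ≠ 0 := hs
  exact mul_pos (hd s) (by positivity)

/-! ### Matrix form of the averages and on-policy nonsingularity -/

variable [DecidableEq S]

theorem gram_mulVec_apply (Φ : Matrix S (Fin q) ℝ) (d : S → ℝ) (v : Fin q → ℝ) (i : Fin q) :
    (gram Φ d *ᵥ v) i = ∑ s, d s * ((Φ s ⬝ᵥ v) * Φ s i) := by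
  rw [gram, ← mulVec_mulVec, ← mulVec_mulVec]
  simp only [mulVec, dotProduct, transpose_apply, diagonal_apply, ite_mul, zero_mul,
    Finset.sum_ite_eq, Finset.mem_univ, if_true]
  exact Finset.sum_congr rfl fun s _ => by ring

theorem tdMatrix_mulVec_apply (M : MDP S A) (π : Policy S A) (Φ : Matrix S (Fin q) ℝ) (d : S → ℝ)
    (v : Fin q → ℝ) (i : Fin q) : (tdMatrix M π Φ d *ᵥ v) i
      = ∑ s, d s * ((M.γ * ∑ s', M.transMatrix π s s' * (Φ s' ⬝ᵥ v) - Φ s ⬝ᵥ v) * Φ s i) := by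
  rw [tdMatrix, ← mulVec_mulVec, ← mulVec_mulVec, ← mulVec_mulVec, sub_mulVec, smul_mulVec,
    one_mulVec]
  simp only [mulVec, dotProduct, transpose_apply, diagonal_apply, ite_mul, zero_mul,
    Finset.sum_ite_eq, Finset.mem_univ, if_true, Pi.sub_apply, Pi.smul_apply, smul_eq_mul]
  exact Finset.sum_congr rfl fun s _ => by ring

theorem dotProduct_tdMatrix_mulVec (M : MDP S A) (π : Policy S A) (Φ : Matrix S (Fin q) ℝ)
    (d : S → ℝ) (u v : Fin q → ℝ) : u ⬝ᵥ (tdMatrix M π Φ d *ᵥ v)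
      = ∑ s, d s * ((M.γ * ∑ s', M.transMatrix π s s' * (Φ s' ⬝ᵥ v) - Φ s ⬝ᵥ v)
        * (Φ s ⬝ᵥ u)) := by
  set c : S → ℝ := fun s =>
    M.γ * ∑ s', M.transMatrix π s s' * (Φ s' ⬝ᵥ v) - Φ s ⬝ᵥ v
  have h : ∀ i, (tdMatrix M π Φ d *ᵥ v) i = ∑ s, d s * (c s * Φ s i) :=
    tdMatrix_mulVec_apply M π Φ d v
  change _ = ∑ s, d s * (c s * (Φ s ⬝ᵥ u))
  clear_value c
  simp only [dotProduct, h, Finset.mul_sum]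
  rw [Finset.sum_comm]
  exact Finset.sum_congr rfl fun s _ => Finset.sum_congr rfl fun i _ => by ring

theorem transpose_tdMatrix_mulVec_apply (M : MDP S A) (π : Policy S A) (Φ : Matrix S (Fin q) ℝ)
    (d : S → ℝ) (v : Fin q → ℝ) (i : Fin q) : ((tdMatrix M π Φ d)ᵀ *ᵥ v) i
      = ∑ s, d s * ((Φ s ⬝ᵥ v) * (M.γ * ∑ s', M.transMatrix π s s' * Φ s' i - Φ s i)) := by
  have h := dotProduct_transpose_mulVec (tdMatrix M π Φ d) (Pi.single i 1) v
  rw [single_one_dotProduct, dotProduct_tdMatrix_mulVec] at h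
  rw [h]
  simp only [dotProduct_single_one]
  exact Finset.sum_congr rfl fun s _ => by ring

theorem sum_sampleProb_smul_updateConst (M : MDP S A) {π β : Policy S A}
    (hcover : ∀ s a, β.prob s a = 0 → π.prob s a = 0) (Φ : Matrix S (Fin q) ℝ) (d : S → ℝ) :
    ∑ x, sampleProb M β d x • updateConst M π β Φ x
      = (0, Φᵀ *ᵥ (diagonal d *ᵥ M.expReward π)) := by
  ext i
  · simp [updateConst, Prod.fst_sum]
  · simp only [updateConst, Prod.snd_sum, Finset.sum_apply, Prod.smul_snd, Pi.smul_apply,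
      smul_eq_mul]
    have : ∀ x, sampleProb M β d x * (impRatio π β x.1 x.2.1 * M.r x.1 x.2.1 x.2.2 * Φ x.1 i)
        = sampleProb M π d x * (M.r x.1 x.2.1 x.2.2 * Φ x.1 i) := by
      intro x
      rw [← sampleProb_mul_impRatio M hcover]
      ring
    simp only [this]
    rw [sum_sampleProb_mul_reward M π d fun s => Φ s i]
    simp only [mulVec, dotProduct, transpose_apply, diagonal_apply, ite_mul, zero_mul,
      Finset.sum_ite_eq, Finset.mem_univ, if_true]
    exact Finset.sum_congr rfl fun s _ => by ring

/-- Only successor features carry the ratio; those terms average under `π` and the others under `β`,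
which together reproduce `A`, `Aᵀ` and `B`. -/
theorem sum_sampleProb_smul_updateLinear (M : MDP S A) {π β : Policy S A}
    (hcover : ∀ s a, β.prob s a = 0 → π.prob s a = 0) (Φ : Matrix S (Fin q) ℝ) (d : S → ℝ)
    (σ : ℝ) (u : (Fin q → ℝ) × (Fin q → ℝ)) :
    ∑ x, sampleProb M β d x • updateLinear M π β Φ σ x u
      = meanField (tdMatrix M π Φ d) (gram Φ d) σ u := by
  ext i
  · simp only [updateLinear, meanField, LinearMap.coe_mk, AddHom.coe_mk, Prod.fst_sum,
      Finset.sum_apply, Prod.smul_fst, Pi.smul_apply, Pi.sub_apply, Pi.neg_apply, smul_eq_mul,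
      gram_mulVec_apply, transpose_tdMatrix_mulVec_apply]
    have : ∀ x, sampleProb M β d x * ((Φ x.1 ⬝ᵥ u.2)
          * (Φ x.1 i - M.γ * impRatio π β x.1 x.2.1 * Φ x.2.2 i) - (Φ x.1 ⬝ᵥ u.1) * Φ x.1 i)
        = sampleProb M β d x * ((Φ x.1 ⬝ᵥ u.2) * Φ x.1 i - (Φ x.1 ⬝ᵥ u.1) * Φ x.1 i)
          - sampleProb M π d x * (M.γ * (Φ x.1 ⬝ᵥ u.2) * Φ x.2.2 i) := by
      intro x
      rw [← sampleProb_mul_impRatio M hcover]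
      ring
    simp only [this]
    rw [Finset.sum_sub_distrib,
      sum_sampleProb_mul M β d fun s => (Φ s ⬝ᵥ u.2) * Φ s i - (Φ s ⬝ᵥ u.1) * Φ s i,
      sum_sampleProb_mul_snd M π d fun s s' => M.γ * (Φ s ⬝ᵥ u.2) * Φ s' i,
      ← Finset.sum_neg_distrib, ← Finset.sum_sub_distrib, ← Finset.sum_sub_distrib]
    refine Finset.sum_congr rfl fun s _ => ?_
    have : ∑ s', M.transMatrix π s s' * (M.γ * (Φ s ⬝ᵥ u.2) * Φ s' i)
        = M.γ * (Φ s ⬝ᵥ u.2) * ∑ s', M.transMatrix π s s' * Φ s' i := by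
      rw [Finset.mul_sum]
      exact Finset.sum_congr rfl fun _ _ => by ring
    rw [this]
    ring
  · simp only [updateLinear, meanField, LinearMap.coe_mk, AddHom.coe_mk, Prod.snd_sum,
      Finset.sum_apply, Prod.smul_snd, Pi.smul_apply, Pi.sub_apply, smul_eq_mul,
      gram_mulVec_apply, tdMatrix_mulVec_apply]
    have : ∀ x, sampleProb M β d x * ((M.γ * impRatio π β x.1 x.2.1 * (Φ x.2.2 ⬝ᵥ u.1)
          - Φ x.1 ⬝ᵥ u.1 - σ * (Φ x.1 ⬝ᵥ u.2)) * Φ x.1 i)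
        = sampleProb M π d x * (M.γ * Φ x.1 i * (Φ x.2.2 ⬝ᵥ u.1))
          - sampleProb M β d x * ((Φ x.1 ⬝ᵥ u.1 + σ * (Φ x.1 ⬝ᵥ u.2)) * Φ x.1 i) := by
      intro x
      rw [← sampleProb_mul_impRatio M hcover]
      ring
    simp only [this]
    rw [Finset.sum_sub_distrib,
      sum_sampleProb_mul M β d fun s => (Φ s ⬝ᵥ u.1 + σ * (Φ s ⬝ᵥ u.2)) * Φ s i,
      sum_sampleProb_mul_snd M π d fun s s' => M.γ * Φ s i * (Φ s' ⬝ᵥ u.1),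
      Finset.mul_sum, ← Finset.sum_sub_distrib, ← Finset.sum_sub_distrib]
    refine Finset.sum_congr rfl fun s _ => ?_
    have : ∑ s', M.transMatrix π s s' * (M.γ * Φ s i * (Φ s' ⬝ᵥ u.1))
        = M.γ * Φ s i * ∑ s', M.transMatrix π s s' * (Φ s' ⬝ᵥ u.1) := by
      rw [Finset.mul_sum]
      exact Finset.sum_congr rfl fun _ _ => by ring
    rw [this]
    ring

theorem gram_isSymm (Φ : Matrix S (Fin q) ℝ) (d : S → ℝ) : (gram Φ d).IsSymm := by
  simp [Matrix.IsSymm, gram, Matrix.mul_assoc]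

theorem dotProduct_gram_mulVec (Φ : Matrix S (Fin q) ℝ) (d : S → ℝ) (v : Fin q → ℝ) :
    v ⬝ᵥ (gram Φ d *ᵥ v) = ∑ s, d s * (Φ s ⬝ᵥ v) ^ 2 := by
  rw [dotProduct]
  simp only [gram_mulVec_apply, Finset.mul_sum]
  rw [Finset.sum_comm]
  refine Finset.sum_congr rfl fun s _ => ?_
  rw [sq, ← mul_assoc]
  nth_rewrite 3 [dotProduct]
  rw [Finset.mul_sum]
  exact Finset.sum_congr rfl fun i _ => by ring

/-- The on-policy matrix is negative definite. -/
theorem isUnit_tdMatrix_of_stationary {M : MDP S A} {β : Policy S A} {d : S → ℝ}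
    (hd : IsPosStationary M β d) {Φ : Matrix S (Fin q) ℝ} (hΦ : Φ.rank = q) :
    IsUnit (tdMatrix M β Φ d) := by
  refine isUnit_of_forall_mulVec_eq_zero fun v hv => ?_
  by_contra hne
  have hpos := sum_mul_sq_pos hd.pos hΦ hne
  have h := dotProduct_tdMatrix_mulVec M β Φ d v v
  rw [hv, dotProduct_zero] at h
  set y : S → ℝ := fun s => Φ s ⬝ᵥ v with hy
  -- By stationarity, current and successor states have the same law, so the two halves of the bound
  -- `y s' * y s ≤ y s' ^ 2 / 2 + y s ^ 2 / 2` have equal averages. Then `γ < 1` gives negative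
  -- definiteness.
  have h1 : ∑ s, d s * ∑ s', M.transMatrix β s s' * (1 / 2 * y s' ^ 2 + 1 / 2 * y s ^ 2)
      = ∑ s, d s * y s ^ 2 := by
    have e1 : ∑ s, d s * ∑ s', M.transMatrix β s s' * (1 / 2 * y s' ^ 2)
        = 1 / 2 * ∑ s, d s * y s ^ 2 := by
      simp only [Finset.mul_sum]
      rw [Finset.sum_comm]
      refine Finset.sum_congr rfl fun s' _ => ?_
      rw [← hd.stationary s', Finset.sum_mul, Finset.mul_sum]
      exact Finset.sum_congr rfl fun s _ => by ring
    have e2 : ∑ s, d s * ∑ s', M.transMatrix β s s' * (1 / 2 * y s ^ 2)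
        = 1 / 2 * ∑ s, d s * y s ^ 2 := by
      rw [Finset.mul_sum]
      refine Finset.sum_congr rfl fun s _ => ?_
      rw [← Finset.sum_mul, sum_transMatrix]
      ring
    simp only [mul_add, Finset.sum_add_distrib]
    rw [e1, e2]
    ring
  have h2 : ∑ s, d s * ((∑ s', M.transMatrix β s s' * y s') * y s) ≤ ∑ s, d s * y s ^ 2 := by
    rw [← h1]
    refine Finset.sum_le_sum fun s _ => mul_le_mul_of_nonneg_left ?_ (hd.pos s).le
    rw [Finset.sum_mul]
    refine Finset.sum_le_sum fun s' _ => ?_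
    rw [mul_assoc]
    refine mul_le_mul_of_nonneg_left ?_ (transMatrix_nonneg M β s s')
    nlinarith [sq_nonneg (y s' - y s)]
  have h3 : ∑ s, d s * ((M.γ * ∑ s', M.transMatrix β s s' * y s' - y s) * y s)
      = M.γ * ∑ s, d s * ((∑ s', M.transMatrix β s s' * y s') * y s) - ∑ s, d s * y s ^ 2 := by
    rw [Finset.mul_sum, ← Finset.sum_sub_distrib]
    exact Finset.sum_congr rfl fun s _ => by ring
  rw [h3] at h
  have h4 := mul_le_mul_of_nonneg_left h2 M.γ_pos.le
  have h5 := mul_pos (sub_pos.2 M.γ_lt_one) hpos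
  linarith

theorem lagrangian_eq (M : MDP S A) (π : Policy S A) (Φ : Matrix S (Fin q) ℝ) (d : S → ℝ)
    (σ : ℝ) : lagrangian M π Φ d σ = fun θ w => σ / 2 * (θ ⬝ᵥ (gram Φ d *ᵥ θ))
      + w ⬝ᵥ (Φᵀ *ᵥ (diagonal d *ᵥ M.expReward π) + tdMatrix M π Φ d *ᵥ θ)
      - 1 / 2 * (w ⬝ᵥ (gram Φ d *ᵥ w)) := by
  funext θ w
  rw [lagrangian, add_sub_assoc (M.expReward π), mulVec_add, mulVec_add, tdMatrix, ← mulVec_mulVec,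
    ← mulVec_mulVec, ← mulVec_mulVec, sub_mulVec, smul_mulVec, one_mulVec]

theorem biasMatrix_eq (M : MDP S A) (π : Policy S A) (Φ : Matrix S (Fin q) ℝ) (d : S → ℝ) :
    biasMatrix M π Φ d = gram Φ d * (tdMatrix M π Φ d)ᵀ⁻¹ * gram Φ d := by
  simp only [biasMatrix, tdMatrix, transpose_mul, transpose_transpose, diagonal_transpose,
    Matrix.mul_assoc]

end MeanUpdate

end GTD

/-! ### Assembly of the main theorem -/

theorem mainTheorem2
    {S A : Type*} [Fintype S] [DecidableEq S] [Fintype A]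
    [MeasurableSpace S] [MeasurableSingletonClass S]
    [MeasurableSpace A] [MeasurableSingletonClass A]
    {Ω : Type*} [MeasurableSpace Ω] (μ : Measure Ω) [IsProbabilityMeasure μ]
    (M : GTD.MDP S A) (π β : GTD.Policy S A)
    (hcover : ∀ s a, β.prob s a = 0 → π.prob s a = 0)
    (d : S → ℝ) (hd : GTD.IsPosStationary M β d)
    {q : ℕ} (Φ : Matrix S (Fin q) ℝ) (hΦ : Φ.rank = q)
    (σ : ℝ) (hσ : 0 ≤ σ)
    -- for `σ = 0`: either on-policy sampling, or `Φᵀ D (γ P^π - I) Φ` is nonsingular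
    (hns : σ = 0 → π = β ∨ IsUnit (GTD.tdMatrix M π Φ d))
    (α : ℕ → ℝ) (hαpos : ∀ k, 0 < α k)
    (hαsum : Tendsto (fun n => ∑ k ∈ Finset.range n, α k) atTop atTop)
    (hαsq : Summable (fun k => α k ^ 2))
    (X : ℕ → Ω → S × A × S) (hX : GTD.IsSampling M β d μ X)
    (θ₀ w₀ : Fin q → ℝ) :
    ∃ p : (Fin q → ℝ) × (Fin q → ℝ),
      GTD.IsSaddlePoint (GTD.lagrangian M π Φ d σ) p ∧
      (∀ p', GTD.IsSaddlePoint (GTD.lagrangian M π Φ d σ) p' → p' = p) ∧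
      (π = β → IsUnit (GTD.tdMatrix M π Φ d)) ∧
      (IsUnit (GTD.tdMatrix M π Φ d) →
        IsUnit (GTD.tdMatrix M π Φ d + σ • GTD.biasMatrix M π Φ d) ∧
        p.1 = GTD.thetaHat M π Φ d σ) ∧
      ∀ᵐ ω ∂μ, Tendsto
        (fun k => (GTD.gtd4 M π β Φ σ α (θ₀, w₀) (fun i => X i ω) k).1) atTop (𝓝 p.1) := by
  have hon : π = β → IsUnit (GTD.tdMatrix M π Φ d) := by
    rintro rfl
    exact GTD.isUnit_tdMatrix_of_stationary hd hΦ
  have hA : σ = 0 → IsUnit (GTD.tdMatrix M π Φ d) := fun h => (hns h).elim hon id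
  have hpos : ∀ v, v ≠ 0 → 0 < v ⬝ᵥ (GTD.gram Φ d *ᵥ v) := fun v hv => by
    rw [GTD.dotProduct_gram_mulVec]
    exact GTD.sum_mul_sq_pos hd.pos hΦ hv
  obtain ⟨u, hu⟩ := GTD.exists_meanField_eq hσ hA hpos
    (-(0, Φᵀ *ᵥ (Matrix.diagonal d *ᵥ M.expReward π)))
  have h1 : -((GTD.tdMatrix M π Φ d)ᵀ *ᵥ u.2) - GTD.gram Φ d *ᵥ u.1 = 0 := by
    simpa [GTD.meanField] using congrArg Prod.fst hu
  have h2 : GTD.tdMatrix M π Φ d *ᵥ u.1 - σ • (GTD.gram Φ d *ᵥ u.2)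
      = -(Φᵀ *ᵥ (Matrix.diagonal d *ᵥ M.expReward π)) := by
    simpa [GTD.meanField] using congrArg Prod.snd hu
  -- Multiplying the first equilibrium equation by `σ` and setting `λ = σ w` gives the critical
  -- point equations; for `σ = 0` the multiplier is zero.
  have hcrit : σ • GTD.gram Φ d *ᵥ u.1 + (GTD.tdMatrix M π Φ d)ᵀ *ᵥ (σ • u.2) = 0 ∧
      Φᵀ *ᵥ (Matrix.diagonal d *ᵥ M.expReward π) + GTD.tdMatrix M π Φ d *ᵥ u.1
        = GTD.gram Φ d *ᵥ (σ • u.2) := by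
    constructor
    · rw [mulVec_smul, ← smul_add, add_comm, ← neg_eq_zero, ← smul_neg, neg_add, ← sub_eq_add_neg,
        h1, smul_zero]
    · rw [mulVec_smul, ← sub_eq_zero, add_sub_assoc, h2, add_neg_cancel]
  rw [GTD.lagrangian_eq]
  simp only [GTD.isSaddlePoint_iff hσ (GTD.gram_isSymm Φ d) hpos]
  refine ⟨(u.1, σ • u.2), hcrit, fun p' hp' => GTD.critical_point_unique hσ hA hpos hcrit hp',
    hon, fun hU => ?_, ?_⟩
  · rw [GTD.thetaHat, GTD.biasMatrix_eq]
    exact GTD.equilibrium_fst_eq (u := u) hσ hU hpos hu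
  obtain ⟨ε, hQpos, hQneg⟩ := GTD.exists_lyapunovForm hσ hA hpos
  have hprob : ∀ k x, μ.real (X k ⁻¹' {x}) = GTD.sampleProb M β d x := by
    rintro k ⟨s, a, s'⟩
    have h := hX.law k s a s'
    rw [measureReal_def, show X k ⁻¹' {(s, a, s')} = {ω | X k ω = (s, a, s')} from rfl, h,
      ENNReal.toReal_ofReal]
    · rfl
    · exact mul_nonneg (mul_nonneg (hd.pos s).le (β.nonneg s a)) (M.P_nonneg s a s')
  have hsum : ∑ x, GTD.sampleProb M β d x = 1 := by
    have := GTD.sum_sampleProb_mul M β d fun _ => 1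
    simpa [hd.sum_eq_one] using this
  -- The recursion is centred at the equilibrium `u`, so the noise `h` is the whole update direction
  -- at `u` and has mean zero.
  have hlim := GTD.ae_tendsto_of_linear_recursion (μ := μ) (y₀ := u) (z₀ := (θ₀, w₀)) (α := α)
    (z := fun k ω => GTD.gtd4 M π β Φ σ α (θ₀, w₀) (fun i => X i ω) k)
    (G := GTD.updateLinear M π β Φ σ)
    (h := fun x => GTD.updateLinear M π β Φ σ x u + GTD.updateConst M π β Φ x)
    (Q := GTD.lyapunovForm (GTD.tdMatrix M π Φ d) ε)
    hX.measurable hX.indep hprob hsum (fun ω => rfl)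
    (fun k ω => by rw [GTD.gtd4_succ, map_sub]; simp only [← add_assoc, sub_add_cancel])
    (by
      simp only [smul_add, Finset.sum_add_distrib]
      rw [GTD.sum_sampleProb_smul_updateLinear M hcover,
        GTD.sum_sampleProb_smul_updateConst M hcover, hu, neg_add_cancel])
    (GTD.lyapunovForm_comm _ _) hQpos
    (fun v hv => by
      rw [GTD.sum_sampleProb_smul_updateLinear M hcover]
      exact hQneg v hv)
    (fun k => (hαpos k).le) hαsum hαsq
  filter_upwards [hlim] with ω hω
  exact (continuous_fst.tendsto u).comp hω
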